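/- Let $\mathbb{O}=\mathbb{H}\oplus\mathbb{H}$ be the octonions with the product $(a,b)(c,d)=(ac-db^{*},\,a^{*}d+cb)$, the conjugation $\overline{(a,b)}=(a^{*},-b)$ and the standard Euclidean inner product, and write $\mathbb{H}=\mathbb{H}\times\{0\}\subset\mathbb{O}$. A four-dimensional real subspace $C\subset\mathbb{O}$ is called $\mathbb{H}$-Lagrangian if there is a four-dimensional real subspace $L\subset\operatorname{Im}\mathbb{O}$ such that $Cu\perp C$ for every unit vector $u\in L$. Let $Spin(7)$ be the group of all linear isometries $\phi$ of $\mathbb{O}$ for which there is $\theta\in SO(\mathbb{O})$ with $\phi(vx)=\phi(v)\theta(x)$ for all $v,x\in\mathbb{O}$. Let $\Theta$ be the Cayley four-form $\Theta(x,y,z,w)=\langle x,\,y\times z\times w\rangle$ on $\mathbb{O}$, where $y\times z\times w=\tfrac12\bigl(y(\bar z w)-w(\bar z y)\bigr)$. A four-dimensional subspace $C$ is calibrated by $\Theta$ if $\Theta$ is a calibration, i.e. $\Theta(v_1,\dots,v_4)\le 1$ for all orthonormal $v_1,\dots,v_4\in\mathbb{O}$, and $\Theta|_C$ is the volume form of $C$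 for one of the two orientations of $C$. The $\mathbb{H}$-Lagrangian subspaces of $\mathbb{O}$ are exactly the Cayley subspaces in the sense of Harvey and Lawson, under both descriptions of the latter. That is, for every four-dimensional real subspace $C\subset\mathbb{O}$: 1. $C$ is $\mathbb{H}$-Lagrangian if and only if $C=\phi(\mathbb{H})$ for some $\phi\in Spin(7)$; 2. $C$ is $\mathbb{H}$-Lagrangian if and only if $C$ is calibrated by $\Theta$. -/

import Mathlib

open scoped Quaternion RealInnerProductSpace

/-- The octonions `𝕆 = ℍ ⊕ ℍ` as a real vector space, with the orthogonal direct sum inner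
product (so `‖(a, b)‖² = ‖a‖² + ‖b‖²`). -/
abbrev Octonion : Type := WithLp 2 (ℍ[ℝ] × ℍ[ℝ])

namespace Octonion

/-- The Cayley–Dickson product `(a, b) (c, d) = (a c - d b*, a* d + c b)`. -/
noncomputable instance : Mul Octonion where
  mul x y := WithLp.toLp 2
    (x.fst * y.fst - y.snd * star x.snd, star x.fst * y.snd + y.fst * x.snd)

/-- The Cayley–Dickson conjugation `(a, b)* = (a*, -b)`. -/
noncomputable def conj (x : Octonion) : Octonion := WithLp.toLp 2 (star x.fst, -x.snd)

theorem mul_fst (x y : Octonion) :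
    (x * y).fst = x.fst * y.fst - y.snd * star x.snd := rfl

theorem mul_snd (x y : Octonion) :
    (x * y).snd = star x.fst * y.snd + y.fst * x.snd := rfl

theorem conj_fst (x : Octonion) : (conj x).fst = star x.fst := rfl

theorem conj_snd (x : Octonion) : (conj x).snd = -x.snd := rfl

@[ext]
theorem ext {x y : Octonion} (h₁ : x.fst = y.fst) (h₂ : x.snd = y.snd) : x = y :=
  WithLp.ofLp_injective 2 (Prod.ext h₁ h₂)

theorem add_mul' (x y z : Octonion) : (x + y) * z = x * z + y * z := by
  ext1
  · simp only [mul_fst, WithLp.add_fst, WithLp.add_snd, star_add]; noncomm_ring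
  · simp only [mul_snd, WithLp.add_fst, WithLp.add_snd, star_add]; noncomm_ring

theorem mul_add' (x y z : Octonion) : x * (y + z) = x * y + x * z := by
  ext1
  · simp only [mul_fst, WithLp.add_fst, WithLp.add_snd]; noncomm_ring
  · simp only [mul_snd, WithLp.add_fst, WithLp.add_snd]; noncomm_ring

theorem smul_mul' (r : ℝ) (x y : Octonion) : (r • x) * y = r • (x * y) := by
  ext1
  · simp [mul_fst, smul_sub]
  · simp [mul_snd, smul_add]

theorem mul_smul' (r : ℝ) (x y : Octonion) : x * (r • y) = r • (x * y) := by
  ext1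
  · simp [mul_fst, smul_sub]
  · simp [mul_snd, smul_add]

theorem conj_add (x y : Octonion) : conj (x + y) = conj x + conj y := by
  ext1
  · simp [conj_fst]
  · simp [conj_snd, add_comm]

theorem conj_smul (r : ℝ) (x : Octonion) : conj (r • x) = r • conj x := by
  ext1
  · simp [conj_fst]
  · simp [conj_snd]

/-- The imaginary octonions. -/
def imaginary : Submodule ℝ Octonion where
  carrier := {x | x.fst.re = 0}
  add_mem' := by
    intro x y hx hy
    simp only [Set.mem_ofPred_eq] at hx hy ⊢
    simp [hx, hy]
  zero_mem' := by simp
  smul_mem' := by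
    intro r x hx
    simp only [Set.mem_ofPred_eq] at hx ⊢
    simp [hx]

/-- The subspace `ℍ = ℍ × {0}` of `𝕆`. -/
def quaternions : Submodule ℝ Octonion where
  carrier := {x | x.snd = 0}
  add_mem' := by
    intro x y hx hy
    simp only [Set.mem_ofPred_eq] at hx hy ⊢
    simp [hx, hy]
  zero_mem' := by simp
  smul_mem' := by
    intro r x hx
    simp only [Set.mem_ofPred_eq] at hx ⊢
    simp [hx]

/-- `J_u y = y u`, right multiplication by `u`. -/
noncomputable def J (u : Octonion) : Octonion →ₗ[ℝ] Octonion where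
  toFun y := y * u
  map_add' x y := add_mul' x y u
  map_smul' r x := smul_mul' r x u

/-- A four-dimensional real subspace `C` of `𝕆` is `ℍ`-Lagrangian if `J_u C ⟂ C` for all unit
vectors `u` in some four-dimensional real subspace `L` of `Im 𝕆`. -/
def IsHLagrangian (C : Submodule ℝ Octonion) : Prop :=
  Module.finrank ℝ C = 4 ∧
    ∃ L : Submodule ℝ Octonion, L ≤ imaginary ∧ Module.finrank ℝ L = 4 ∧
      ∀ u ∈ L, ‖u‖ = 1 → C.map (J u) ⟂ C

/-- `Spin(7) ⊂ O(8)`: the group of those linear isometries `φ` of `𝕆` that are twisted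
isomorphisms, i.e. `φ (v x) = φ v * θ x` for some `θ ∈ SO(𝕆)`. -/
noncomputable def spin7 : Subgroup (Octonion ≃ₗᵢ[ℝ] Octonion) where
  carrier := {φ | ∃ θ : Octonion ≃ₗᵢ[ℝ] Octonion,
    LinearMap.det (θ.toLinearEquiv : Octonion →ₗ[ℝ] Octonion) = 1 ∧
      ∀ v x : Octonion, φ (v * x) = φ v * θ x}
  one_mem' := ⟨1, LinearMap.det_id, fun _ _ => rfl⟩
  mul_mem' := by
    rintro φ ψ ⟨θ, hθ, h⟩ ⟨η, hη, k⟩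
    refine ⟨θ * η, ?_, fun v x => ?_⟩
    · have e : (((θ * η : Octonion ≃ₗᵢ[ℝ] Octonion).toLinearEquiv :
          Octonion ≃ₗ[ℝ] Octonion) : Octonion →ₗ[ℝ] Octonion) =
          (θ.toLinearEquiv : Octonion →ₗ[ℝ] Octonion) ∘ₗ
            (η.toLinearEquiv : Octonion →ₗ[ℝ] Octonion) := rfl
      rw [e, LinearMap.det_comp, hθ, hη, one_mul]
    · change φ (ψ (v * x)) = φ (ψ v) * θ (η x)
      rw [k, h]
  inv_mem' := by
    rintro φ ⟨θ, hθ, h⟩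
    refine ⟨θ⁻¹, ?_, fun v x => ?_⟩
    · have e := LinearEquiv.det_symm_mul_det θ.toLinearEquiv
      rw [hθ, mul_one] at e
      exact e
    · change φ.symm (v * x) = φ.symm v * θ.symm x
      rw [LinearIsometryEquiv.symm_apply_eq, h, LinearIsometryEquiv.apply_symm_apply,
        LinearIsometryEquiv.apply_symm_apply]

/-- The images of `ℍ ⊂ 𝕆` under `Spin(7)`. -/
def IsSpin7Translate (C : Submodule ℝ Octonion) : Prop :=
  ∃ φ ∈ spin7, C = quaternions.map (φ.toLinearEquiv : Octonion →ₗ[ℝ] Octonion)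

/-- The triple cross product `x × y × z = ½ (x (y* z) - z (y* x))`. -/
noncomputable def tripleCross (x y z : Octonion) : Octonion :=
  (1 / 2 : ℝ) • (x * (conj y * z) - z * (conj y * x))

theorem inner_eq (x y : Octonion) :
    ⟪x, y⟫ = x.fst.re * y.fst.re + x.fst.imI * y.fst.imI + x.fst.imJ * y.fst.imJ
      + x.fst.imK * y.fst.imK + x.snd.re * y.snd.re + x.snd.imI * y.snd.imI
      + x.snd.imJ * y.snd.imJ + x.snd.imK * y.snd.imK := by
  rw [WithLp.prod_inner_apply, Quaternion.inner_def, Quaternion.inner_def]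
  simp [Quaternion.re_mul]
  ring

theorem mul_conj_mul (x z : Octonion) : x * (conj x * z) = z * (conj x * x) := by
  have hcoe : ∀ (r : ℝ) (q : ℍ[ℝ]), (r : ℍ[ℝ]) * q = q * (r : ℍ[ℝ]) := fun r q =>
    Quaternion.coe_commutes r q
  have h1 := Quaternion.self_mul_star x.fst
  have h2 := Quaternion.star_mul_self x.fst
  have h3 := Quaternion.self_mul_star x.snd
  have h4 := Quaternion.star_mul_self x.snd
  ext1
  · simp only [mul_fst, mul_snd, conj_fst, conj_snd, star_neg, star_star]
    simp only [mul_add, add_mul, mul_neg, neg_mul, sub_neg_eq_add, mul_assoc, h2, h3]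
    simp only [← mul_assoc, h1, hcoe]
    abel
  · simp only [mul_fst, mul_snd, conj_fst, conj_snd, star_neg, star_star]
    simp only [mul_add, add_mul, mul_neg, sub_neg_eq_add, mul_assoc, h2, h3, h4]
    simp only [← mul_assoc, h2, hcoe]
    abel

theorem tripleCross_self (x y z : Octonion) :
    tripleCross x y x = 0 ∧ tripleCross x x z = 0 ∧ tripleCross z x x = 0 := by
  refine ⟨by simp [tripleCross], ?_, ?_⟩ <;> simp [tripleCross, mul_conj_mul]

theorem inner_tripleCross_self (x y z : Octonion) :
    ⟪x, tripleCross x y z⟫ = 0 ∧ ⟪x, tripleCross y x z⟫ = 0 ∧ ⟪x, tripleCross y z x⟫ = 0 := by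
  refine ⟨?_, ?_, ?_⟩ <;>
  · rw [inner_eq]
    simp [tripleCross, mul_fst, mul_snd, conj_fst, conj_snd, Quaternion.re_mul,
      Quaternion.imI_mul, Quaternion.imJ_mul, Quaternion.imK_mul]
    ring

theorem cayleyForm_aux_add (v : Fin 4 → Octonion) (i : Fin 4) (x y : Octonion) :
    let f : (Fin 4 → Octonion) → ℝ := fun w => ⟪w 0, tripleCross (w 1) (w 2) (w 3)⟫
    f (Function.update v i (x + y)) = f (Function.update v i x) + f (Function.update v i y) := by
  have h01 : (0 : Fin 4) ≠ 1 := by decide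
  have h02 : (0 : Fin 4) ≠ 2 := by decide
  have h03 : (0 : Fin 4) ≠ 3 := by decide
  have h12 : (1 : Fin 4) ≠ 2 := by decide
  have h13 : (1 : Fin 4) ≠ 3 := by decide
  have h23 : (2 : Fin 4) ≠ 3 := by decide
  have hi : i = 0 ∨ i = 1 ∨ i = 2 ∨ i = 3 := by omega
  rcases hi with rfl | rfl | rfl | rfl <;>
  · simp only [Function.update_self, Function.update_of_ne, h01, h02, h03, h12, h13, h23, h01.symm,
      h02.symm, h03.symm, h12.symm, h13.symm, h23.symm, ne_eq, not_false_eq_true, tripleCross,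
      conj_add, add_mul', mul_add', inner_add_left, inner_add_right, inner_sub_right,
      inner_smul_right]
    try ring

theorem cayleyForm_aux_smul (v : Fin 4 → Octonion) (i : Fin 4) (r : ℝ) (x : Octonion) :
    let f : (Fin 4 → Octonion) → ℝ := fun w => ⟪w 0, tripleCross (w 1) (w 2) (w 3)⟫
    f (Function.update v i (r • x)) = r • f (Function.update v i x) := by
  have h01 : (0 : Fin 4) ≠ 1 := by decide
  have h02 : (0 : Fin 4) ≠ 2 := by decide
  have h03 : (0 : Fin 4) ≠ 3 := by decide
  have h12 : (1 : Fin 4) ≠ 2 := by decide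
  have h13 : (1 : Fin 4) ≠ 3 := by decide
  have h23 : (2 : Fin 4) ≠ 3 := by decide
  have hi : i = 0 ∨ i = 1 ∨ i = 2 ∨ i = 3 := by omega
  rcases hi with rfl | rfl | rfl | rfl <;>
  · simp only [Function.update_self, Function.update_of_ne, h01, h02, h03, h12, h13, h23, h01.symm,
      h02.symm, h03.symm, h12.symm, h13.symm, h23.symm, ne_eq, not_false_eq_true, tripleCross,
      conj_smul, smul_mul', mul_smul', real_inner_smul_left, inner_sub_right,
      real_inner_smul_right, smul_eq_mul]
    try ring

/-- The Cayley four-form `Θ (x, y, z, w) = ⟨x, y × z × w⟩` on `𝕆`. -/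
noncomputable def cayleyForm : Octonion [⋀^Fin 4]→ₗ[ℝ] ℝ :=
  { MultilinearMap.mk' (fun v : Fin 4 → Octonion => ⟪v 0, tripleCross (v 1) (v 2) (v 3)⟫)
      cayleyForm_aux_add cayleyForm_aux_smul with
    map_eq_zero_of_eq' := by
      intro v i j h hij
      change ⟪v 0, tripleCross (v 1) (v 2) (v 3)⟫ = 0
      fin_cases i <;> fin_cases j <;>
      first
      | exact absurd rfl hij
      | (simp only [Fin.mk_zero, Fin.mk_one, Fin.reduceFinMk, Fin.isValue] at h
         simp only [h]
         simp only [(tripleCross_self _ _ 0).1, (tripleCross_self _ 0 _).2.1,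
           (tripleCross_self _ 0 _).2.2, (inner_tripleCross_self _ _ _).1,
           (inner_tripleCross_self _ _ _).2.1, (inner_tripleCross_self _ _ _).2.2,
           inner_zero_right]) }

theorem cayleyForm_apply (v : Fin 4 → Octonion) :
    cayleyForm v = ⟪v 0, tripleCross (v 1) (v 2) (v 3)⟫ := rfl

end Octonion

/-- A constant-coefficient `k`-form `Φ` on a Euclidean space (such a form is closed) is a volume
calibrating form if `Φ|_P ≤ dv_P` for every oriented `k`-plane `P`. -/
def IsCalibratingForm {E : Type*} [NormedAddCommGroup E] [InnerProductSpace ℝ E] {k : ℕ}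
    (Φ : E [⋀^Fin k]→ₗ[ℝ] ℝ) : Prop :=
  ∀ v : Fin k → E, Orthonormal ℝ v → Φ v ≤ 1

/-- A `k`-dimensional subspace `C` is calibrated by `Φ` if `Φ` is a volume calibrating form and
`Φ|_C = dv_C` for a suitable orientation of `C`. -/
def IsCalibratedBy {E : Type*} [NormedAddCommGroup E] [InnerProductSpace ℝ E] {k : ℕ}
    (Φ : E [⋀^Fin k]→ₗ[ℝ] ℝ) (C : Submodule ℝ E) : Prop :=
  IsCalibratingForm Φ ∧
    ∃ (_ : Fact (Module.finrank ℝ C = k)) (o : Orientation ℝ C (Fin k)),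
      Φ.compLinearMap C.subtype = o.volumeForm

/-! Everything rests on the adjunction `⟪x * u, y⟫ = ⟪u, conj x * y⟫` (`inner_mul_right`): `C` is
ℍ-Lagrangian for `L` exactly when all products `conj x * y` with `x, y ∈ C` lie in the
four-dimensional space `Lᗮ`.

For Spin(7), a twisted pair `(φ, θ)` carries the condition for `(C, L)` to that for `(φ C, θ L)`,
and `ℍ` satisfies it with `L = {0} × ℍ`; this gives one direction. Conversely, right multiplication
by a unit imaginary `u` lies in `spin7`, and its twist is minus the reflection in `u` on `Im 𝕆`.
Reflections generate the orthogonal group, so every isometry of `Im 𝕆` is a twist up to sign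
(`exists_spin7_twist`), and `L` may be moved to `{0} × ℍ`. Then only `ℍ` and `ℍᗮ` are possible
(`eq_quaternions_or_eq_coquaternions`), and a right multiplication exchanges them.

For the Cayley form, the triple product of orthonormal vectors is the unit vector `x * (conj y *
z)`, so Cauchy–Schwarz gives the calibration bound, with `|Θ| = 1` on an orthonormal basis iff `e 0
= ± e 1 × e 2 × e 3`. This holds iff all `conj (e i) * e j` stay in the four-space `conj (e 1) * C`,
whose complement serves as `L`. -/

namespace Octonion

/-! ### Composition algebra identities -/

/-- The unit octonion `(1, 0)`. -/
noncomputable def unit : Octonion := WithLp.toLp 2 (1, 0)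

theorem unit_fst : unit.fst = 1 := rfl

theorem unit_snd : unit.snd = 0 := rfl

theorem mul_unit (x : Octonion) : x * unit = x := by
  ext1 <;> simp [mul_fst, mul_snd, unit_fst, unit_snd]

theorem inner_unit_left (x : Octonion) : ⟪unit, x⟫ = x.fst.re := by
  rw [inner_eq]
  simp [unit_fst, unit_snd]

theorem norm_unit : ‖unit‖ = 1 := by
  rw [norm_eq_sqrt_real_inner, inner_unit_left, unit_fst]; simp

theorem mem_imaginary {x : Octonion} : x ∈ imaginary ↔ x.fst.re = 0 := Iff.rfl

theorem mem_imaginary_iff_inner {x : Octonion} : x ∈ imaginary ↔ ⟪unit, x⟫ = 0 := by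
  rw [inner_unit_left, mem_imaginary]

theorem mem_quaternions {x : Octonion} : x ∈ quaternions ↔ x.snd = 0 := Iff.rfl

theorem conj_conj (x : Octonion) : conj (conj x) = x := by
  ext1 <;> simp [conj_fst, conj_snd]

theorem conj_eq (x : Octonion) : conj x = (2 * ⟪unit, x⟫) • unit - x := by
  rw [inner_unit_left]
  ext1
  · ext <;> simp [conj_fst, unit_fst]
    ring
  · ext <;> simp [conj_snd, unit_snd]

theorem conj_of_mem_imaginary {x : Octonion} (hx : x ∈ imaginary) : conj x = -x := by
  rw [conj_eq, mem_imaginary_iff_inner.1 hx]; simp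

/-- Polarization of `(z x̄) x = ‖x‖² z`. -/
theorem mul_mul_conj_add (x y z : Octonion) :
    (z * x) * conj y + (z * y) * conj x = (2 * ⟪x, y⟫) • z := by
  rw [inner_eq]
  ext1 <;> ext <;>
  · simp [mul_fst, mul_snd, conj_fst, conj_snd, Quaternion.re_mul,
      Quaternion.imI_mul, Quaternion.imJ_mul, Quaternion.imK_mul]
    ring

/-- Polarization of `x (x̄ z) = ‖x‖² z`. -/
theorem mul_conj_mul_add (x y z : Octonion) :
    x * (conj y * z) + y * (conj x * z) = (2 * ⟪x, y⟫) • z := by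
  rw [inner_eq]
  ext1 <;> ext <;>
  · simp [mul_fst, mul_snd, conj_fst, conj_snd, Quaternion.re_mul,
      Quaternion.imI_mul, Quaternion.imJ_mul, Quaternion.imK_mul]
    ring

theorem conj_mul_add (x y : Octonion) : conj x * y + conj y * x = (2 * ⟪x, y⟫) • unit := by
  rw [inner_eq]
  ext1 <;> ext <;>
  · simp [mul_fst, mul_snd, conj_fst, conj_snd, Quaternion.re_mul, unit_fst, unit_snd,
      Quaternion.imI_mul, Quaternion.imJ_mul, Quaternion.imK_mul]
    try ring

theorem inner_mul_right (x u y : Octonion) : ⟪x * u, y⟫ = ⟪u, conj x * y⟫ := by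
  simp only [inner_eq]
  simp [mul_fst, mul_snd, conj_fst, conj_snd, Quaternion.re_mul,
      Quaternion.imI_mul, Quaternion.imJ_mul, Quaternion.imK_mul]
  ring

theorem self_mul_conj_mul (x z : Octonion) : x * (conj x * z) = (‖x‖ ^ 2) • z := by
  have h := mul_conj_mul_add x x z
  rw [real_inner_self_eq_norm_sq, mul_smul, ← two_smul ℝ] at h
  exact smul_right_injective _ (two_ne_zero : (2 : ℝ) ≠ 0) h

theorem norm_conj (x : Octonion) : ‖conj x‖ = ‖x‖ := by
  rw [norm_eq_sqrt_real_inner, norm_eq_sqrt_real_inner, inner_eq, inner_eq]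
  simp [conj_fst, conj_snd]

theorem conj_mul_self_mul (x z : Octonion) : conj x * (x * z) = (‖x‖ ^ 2) • z := by
  have h := self_mul_conj_mul (conj x) z
  rwa [conj_conj, norm_conj] at h

theorem conj_mul_self (x : Octonion) : conj x * x = (‖x‖ ^ 2) • unit := by
  have h := conj_mul_self_mul x unit
  rwa [mul_unit] at h

theorem norm_mul (x y : Octonion) : ‖x * y‖ = ‖x‖ * ‖y‖ := by
  have h : ‖x * y‖ ^ 2 = (‖x‖ * ‖y‖) ^ 2 := by
    rw [← real_inner_self_eq_norm_sq, inner_mul_right, conj_mul_self_mul, real_inner_smul_right,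
      real_inner_self_eq_norm_sq, mul_pow]
  exact (sq_eq_sq₀ (norm_nonneg _) (by positivity)).1 h

theorem finrank_octonion : Module.finrank ℝ Octonion = 8 := by
  rw [(WithLp.linearEquiv 2 ℝ (ℍ[ℝ] × ℍ[ℝ])).finrank_eq, Module.finrank_prod,
    Quaternion.finrank_eq_four]

theorem mul_neg' (x y : Octonion) : x * -y = -(x * y) := by
  simpa using mul_smul' (-1) x y

theorem mul_sub' (x y z : Octonion) : x * (y - z) = x * y - x * z := by
  rw [sub_eq_add_neg, mul_add', mul_neg', sub_eq_add_neg]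

theorem mul_conj_mul_of_inner_eq_zero {x y : Octonion} (h : ⟪x, y⟫ = 0) (z : Octonion) :
    x * (conj y * z) = -(y * (conj x * z)) := by
  have := mul_conj_mul_add x y z
  rw [h, mul_zero, zero_smul] at this
  exact eq_neg_of_add_eq_zero_left this

theorem conj_mul_of_inner_eq_zero {x y : Octonion} (h : ⟪x, y⟫ = 0) :
    conj x * y = -(conj y * x) := by
  have := conj_mul_add x y
  rw [h, mul_zero, zero_smul] at this
  exact eq_neg_of_add_eq_zero_left this

/-- By the polarized identities, exchanging two adjacent orthogonal factors of `x * (conj y * z)`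
changes its sign. Hence the product is cyclically invariant and the two terms of the cross product
agree. -/
theorem tripleCross_eq_cyclic {x y z : Octonion} (hxy : ⟪x, y⟫ = 0) (hyz : ⟪y, z⟫ = 0)
    (hxz : ⟪x, z⟫ = 0) :
    tripleCross x y z = x * (conj y * z) ∧ tripleCross x y z = y * (conj z * x) ∧
      tripleCross x y z = z * (conj x * y) := by
  have a : x * (conj y * z) = y * (conj z * x) := by
    rw [mul_conj_mul_of_inner_eq_zero hxy, conj_mul_of_inner_eq_zero hxz, mul_neg', neg_neg]
  have b : y * (conj z * x) = z * (conj x * y) := by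
    rw [mul_conj_mul_of_inner_eq_zero hyz,
      conj_mul_of_inner_eq_zero (x := y) (y := x) (by rwa [real_inner_comm]), mul_neg', neg_neg]
  have c : tripleCross x y z = x * (conj y * z) := by
    rw [tripleCross, conj_mul_of_inner_eq_zero (x := y) (y := x) (by rwa [real_inner_comm]), mul_neg', ← b, ← a,
      sub_neg_eq_add, ← two_smul ℝ, smul_smul]
    norm_num
  exact ⟨c, c.trans a, c.trans (a.trans b)⟩

/-! ### Right multiplications in `Spin(7)` -/

/-- Right multiplication by a unit vector as an isometry. -/
noncomputable def rightMul (u : Octonion) (hu : ‖u‖ = 1) : Octonion ≃ₗᵢ[ℝ] Octonion :=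
  LinearIsometry.toLinearIsometryEquiv
    ⟨J u, fun x => by change ‖x * u‖ = _; rw [norm_mul, hu, mul_one]⟩ rfl

/-- The rotation `x ↦ u⁻¹ x u`, as a product of two reflections. -/
noncomputable def rotation (u : Octonion) : Octonion ≃ₗᵢ[ℝ] Octonion :=
  (ℝ ∙ u)ᗮ.reflection * (ℝ ∙ unit).reflection

theorem reflection_unit (x : Octonion) : (ℝ ∙ unit).reflection x = conj x := by
  rw [Submodule.reflection_apply, Submodule.starProjection_unit_singleton ℝ norm_unit, conj_eq,
    mul_smul, two_smul, two_smul]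

theorem reflection_orthogonal_singleton {E : Type*} [NormedAddCommGroup E]
    [InnerProductSpace ℝ E] {u : E} (hu : ‖u‖ = 1) (x : E) :
    (ℝ ∙ u)ᗮ.reflection x = x - (2 * ⟪u, x⟫) • u := by
  rw [Submodule.reflection_orthogonal_apply, Submodule.reflection_apply,
    Submodule.starProjection_unit_singleton ℝ hu, mul_smul, two_smul, two_smul]
  abel

theorem rotation_apply {u : Octonion} (hu : ‖u‖ = 1) (x : Octonion) :
    rotation u x = conj x - (2 * ⟪u, conj x⟫) • u := by
  change (ℝ ∙ u)ᗮ.reflection ((ℝ ∙ unit).reflection x) = _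
  rw [reflection_unit, reflection_orthogonal_singleton hu]

theorem det_rotation {u : Octonion} (hu : ‖u‖ = 1) :
    LinearMap.det ((rotation u).toLinearEquiv : Octonion →ₗ[ℝ] Octonion) = 1 := by
  have e : ((rotation u).toLinearEquiv : Octonion →ₗ[ℝ] Octonion) =
      (ℝ ∙ u)ᗮ.reflection.toLinearMap ∘ₗ (ℝ ∙ unit).reflection.toLinearMap := rfl
  have f (v : Octonion) (hv : ‖v‖ = 1) : Module.finrank ℝ (ℝ ∙ v) = 1 :=
    finrank_span_singleton (by rintro rfl; simp at hv)
  have h := (ℝ ∙ unit).finrank_add_finrank_orthogonal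
  rw [f _ norm_unit, finrank_octonion] at h
  have h' : Module.finrank ℝ (ℝ ∙ unit)ᗮ = 7 := by omega
  -- The reflection in `uᗮ` has determinant `-1` and conjugation has `(-1) ^ 7`.
  rw [e, LinearMap.det_comp, Submodule.det_reflection, Submodule.det_reflection,
    Submodule.orthogonal_orthogonal, f _ hu, h']
  norm_num

/-- Expand the rotation, use `(v * u) * u = -v`, and recognize the polarized identity for `(v * x) *
conj u + (v * u) * conj x`. -/
theorem mul_mul_rotation {u : Octonion} (hu : ‖u‖ = 1) (hi : u ∈ imaginary) (v x : Octonion) :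
    (v * x) * u = (v * u) * rotation u x := by
  have h := mul_mul_conj_add x u v
  have h₁ : v * u * u = -v := by
    have := mul_mul_conj_add u u v
    rw [conj_of_mem_imaginary hi, mul_neg', real_inner_self_eq_norm_sq, hu, one_pow, mul_one,
      two_smul] at this
    have : (2 : ℝ) • (v * u * u) = (2 : ℝ) • (-v) := by
      rw [two_smul, two_smul, ← neg_add, ← this]; abel
    exact smul_right_injective _ (two_ne_zero : (2 : ℝ) ≠ 0) this
  have h₂ : ⟪u, conj x⟫ = -⟪x, u⟫ := by
    rw [conj_eq, inner_sub_right, real_inner_smul_right, real_inner_comm unit u,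
      mem_imaginary_iff_inner.1 hi, real_inner_comm u x]
    ring
  rw [conj_of_mem_imaginary hi, mul_neg'] at h
  rw [rotation_apply hu, mul_sub', mul_smul', h₁, h₂, mul_neg, smul_neg, neg_smul, neg_neg, ← h]
  abel

theorem rightMul_mem_spin7 {u : Octonion} (hu : ‖u‖ = 1) (hi : u ∈ imaginary) :
    rightMul u hu ∈ spin7 :=
  ⟨rotation u, det_rotation hu, mul_mul_rotation hu hi⟩

/-! ### The ℍ-Lagrangian condition under twisted isometries -/

theorem isHLagrangian_iff {C : Submodule ℝ Octonion} :
    IsHLagrangian C ↔ Module.finrank ℝ C = 4 ∧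
      ∃ L : Submodule ℝ Octonion, L ≤ imaginary ∧ Module.finrank ℝ L = 4 ∧
        ∀ u ∈ L, ∀ x ∈ C, ∀ y ∈ C, ⟪x * u, y⟫ = 0 := by
  refine and_congr_right fun _ => exists_congr fun L => and_congr_right fun _ =>
    and_congr_right fun _ => ⟨fun h u hu x hx y hy => ?_, fun h u hu _ => ?_⟩
  · rcases eq_or_ne u 0 with rfl | h0
    · have : x * (0 : Octonion) = 0 := by simpa using mul_smul' 0 x 0
      rw [this, inner_zero_left]
    · have hn : ‖u‖ ≠ 0 := norm_ne_zero_iff.2 h0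
      have := Submodule.isOrtho_iff_inner_eq.1
        (h (‖u‖⁻¹ • u) (L.smul_mem _ hu) (by rw [norm_smul, norm_inv, norm_norm]; field_simp))
        _ (Submodule.mem_map_of_mem hx) y hy
      change ⟪x * (‖u‖⁻¹ • u), y⟫ = 0 at this
      rw [mul_smul', real_inner_smul_left] at this
      exact (mul_eq_zero.1 this).resolve_left (inv_ne_zero hn)
  · rw [Submodule.isOrtho_iff_inner_eq]
    rintro _ ⟨x, hx, rfl⟩ y hy
    exact h u hu x hx y hy

theorem inner_mul_eq_zero_map {C L : Submodule ℝ Octonion} {φ θ : Octonion ≃ₗᵢ[ℝ] Octonion}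
    (hφ : ∀ v x, φ (v * x) = φ v * θ x) (h : ∀ u ∈ L, ∀ x ∈ C, ∀ y ∈ C, ⟪x * u, y⟫ = 0) :
    ∀ u ∈ L.map (θ.toLinearEquiv : Octonion →ₗ[ℝ] Octonion),
      ∀ x ∈ C.map (φ.toLinearEquiv : Octonion →ₗ[ℝ] Octonion),
      ∀ y ∈ C.map (φ.toLinearEquiv : Octonion →ₗ[ℝ] Octonion), ⟪x * u, y⟫ = 0 := by
  rintro _ ⟨u, hu, rfl⟩ _ ⟨x, hx, rfl⟩ _ ⟨y, hy, rfl⟩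
  change ⟪φ x * θ u, φ y⟫ = 0
  rw [← hφ, LinearIsometryEquiv.inner_map_map]
  exact h u hu x hx y hy

theorem mul_left_cancel_of_ne_zero {x y z : Octonion} (hx : x ≠ 0) (h : x * y = x * z) :
    y = z := by
  have := congrArg (conj x * ·) h
  simp only [conj_mul_self_mul] at this
  exact smul_right_injective _ (pow_ne_zero 2 (norm_ne_zero_iff.2 hx)) this

theorem unit_ne_zero : unit ≠ 0 := fun h => by
  have := norm_unit
  rw [h, norm_zero] at this
  exact zero_ne_one this

/-- Put `v = x = unit` in the twist relation and cancel `φ unit`. As `θ` is an isometry, it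
therefore preserves `Im 𝕆`. -/
theorem twist_unit {φ θ : Octonion ≃ₗᵢ[ℝ] Octonion} (h : ∀ v x, φ (v * x) = φ v * θ x) :
    θ unit = unit := by
  refine mul_left_cancel_of_ne_zero (x := φ unit) ?_ ?_
  · simpa using unit_ne_zero
  · rw [← h, mul_unit, mul_unit]

theorem twist_mem_imaginary {φ θ : Octonion ≃ₗᵢ[ℝ] Octonion}
    (h : ∀ v x, φ (v * x) = φ v * θ x) {x : Octonion} (hx : x ∈ imaginary) :
    θ x ∈ imaginary := by
  rw [mem_imaginary_iff_inner] at hx ⊢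
  rw [← twist_unit h, LinearIsometryEquiv.inner_map_map, hx]

/-- The subspace `{0} × ℍ` of `𝕆`. -/
noncomputable def coquaternions : Submodule ℝ Octonion :=
  LinearMap.ker ((LinearMap.fst ℝ ℍ[ℝ] ℍ[ℝ]).comp
    (WithLp.linearEquiv 2 ℝ (ℍ[ℝ] × ℍ[ℝ])).toLinearMap)

theorem mem_coquaternions {x : Octonion} : x ∈ coquaternions ↔ x.fst = 0 := Iff.rfl

theorem coquaternions_le_imaginary : coquaternions ≤ imaginary := fun x hx => by
  rw [mem_coquaternions] at hx
  rw [mem_imaginary, hx]; rfl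

theorem finrank_coquaternions : Module.finrank ℝ coquaternions = 4 := by
  let f : ℍ[ℝ] ≃ₗ[ℝ] coquaternions :=
    { toFun q := ⟨WithLp.toLp 2 (0, q), rfl⟩
      invFun x := x.1.snd
      map_add' x y := Subtype.ext (Octonion.ext (by simp) (by simp))
      map_smul' r x := Subtype.ext (Octonion.ext (by simp) (by simp))
      left_inv _ := rfl
      right_inv x := Subtype.ext (Octonion.ext (mem_coquaternions.1 x.2).symm rfl) }
  rw [← f.finrank_eq, Quaternion.finrank_eq_four]

theorem finrank_quaternions : Module.finrank ℝ quaternions = 4 := by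
  let f : ℍ[ℝ] ≃ₗ[ℝ] quaternions :=
    { toFun q := ⟨WithLp.toLp 2 (q, 0), rfl⟩
      invFun x := x.1.fst
      map_add' x y := Subtype.ext (Octonion.ext (by simp) (by simp))
      map_smul' r x := Subtype.ext (Octonion.ext (by simp) (by simp))
      left_inv _ := rfl
      right_inv x := Subtype.ext (Octonion.ext rfl (mem_quaternions.1 x.2).symm) }
  rw [← f.finrank_eq, Quaternion.finrank_eq_four]

theorem inner_mul_eq_zero_quaternions :
    ∀ u ∈ coquaternions, ∀ x ∈ quaternions, ∀ y ∈ quaternions, ⟪x * u, y⟫ = 0 := by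
  intro u hu x hx y hy
  rw [mem_coquaternions] at hu
  rw [mem_quaternions] at hx hy
  rw [WithLp.prod_inner_apply]
  have h₁ : (x * u).fst = 0 := by rw [mul_fst, hu, hx]; simp
  change ⟪(x * u).fst, y.fst⟫ + ⟪(x * u).snd, y.snd⟫ = 0
  rw [h₁, hy, inner_zero_left, inner_zero_right, add_zero]

theorem finrank_map_isometry (φ : Octonion ≃ₗᵢ[ℝ] Octonion) (C : Submodule ℝ Octonion) :
    Module.finrank ℝ (C.map (φ.toLinearEquiv : Octonion →ₗ[ℝ] Octonion)) =
      Module.finrank ℝ C :=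
  LinearEquiv.finrank_map_eq φ.toLinearEquiv C

theorem IsSpin7Translate.isHLagrangian {C : Submodule ℝ Octonion} (h : IsSpin7Translate C) :
    IsHLagrangian C := by
  obtain ⟨φ, ⟨θ, -, hφ⟩, rfl⟩ := h
  rw [isHLagrangian_iff, finrank_map_isometry, finrank_quaternions]
  refine ⟨rfl, coquaternions.map (θ.toLinearEquiv : Octonion →ₗ[ℝ] Octonion), ?_, ?_,
    inner_mul_eq_zero_map hφ inner_mul_eq_zero_quaternions⟩
  · rintro _ ⟨x, hx, rfl⟩
    exact twist_mem_imaginary hφ (coquaternions_le_imaginary hx)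
  · rw [finrank_map_isometry, finrank_coquaternions]

/-! ### Moving an ℍ-Lagrangian plane to `ℍ` -/

theorem rotation_of_mem_imaginary {u x : Octonion} (hu : ‖u‖ = 1) (hx : x ∈ imaginary) :
    rotation u x = -(x - (2 * ⟪u, x⟫) • u) := by
  rw [rotation_apply hu, conj_of_mem_imaginary hx, inner_neg_right]
  module

/-- Up to sign, every isometry of `Im 𝕆` is the twist of an element of `Spin(7)`. -/
theorem exists_spin7_twist (ψ : imaginary ≃ₗᵢ[ℝ] imaginary) :
    ∃ φ ∈ spin7, ∃ θ : Octonion ≃ₗᵢ[ℝ] Octonion, (∀ v x, φ (v * x) = φ v * θ x) ∧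
      ∃ ε : ℝ, ∀ x : imaginary, θ x = ε • (ψ x : Octonion) := by
  -- Cartan–Dieudonné: `ψ` is a product of reflections, each realized up to sign by a right
  -- multiplication. The accumulated sign `ε` does not affect images of subspaces.
  obtain ⟨l, -, rfl⟩ := ψ.reflections_generate_dim
  induction l with
  | nil => exact ⟨1, one_mem _, 1, fun _ _ => rfl, 1, fun x => (one_smul _ _).symm⟩
  | cons v l ih =>
    obtain ⟨φ, hφ, θ, h, ε, hε⟩ := ih
    rw [List.map_cons, List.prod_cons]
    rcases eq_or_ne v 0 with rfl | hv
    · refine ⟨φ, hφ, θ, h, ε, fun x => ?_⟩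
      rw [hε, LinearIsometryEquiv.coe_mul, Function.comp_apply,
        Submodule.reflection_orthogonal_apply]
      simp
    · have hn : ‖v‖ ≠ 0 := norm_ne_zero_iff.2 hv
      set u : imaginary := ‖v‖⁻¹ • v with hu
      have hu1 : ‖u‖ = 1 := by rw [hu, norm_smul, norm_inv, norm_norm]; field_simp
      have hspan : ℝ ∙ v = ℝ ∙ u :=
        (Submodule.span_singleton_smul_eq (IsUnit.mk0 _ (inv_ne_zero hn)) v).symm
      have hr : (ℝ ∙ v)ᗮ.reflection = (ℝ ∙ u)ᗮ.reflection := by simp only [hspan]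
      have hu1' : ‖(u : Octonion)‖ = 1 := hu1
      refine ⟨rightMul u hu1' * φ, mul_mem (rightMul_mem_spin7 hu1' u.2) hφ, rotation u * θ,
        fun a x => ?_, -ε, fun x => ?_⟩
      · change φ (a * x) * u = φ a * u * rotation u (θ x)
        rw [h, mul_mul_rotation hu1' u.2]
      · change rotation u (θ x) = _
        rw [hε, map_smul, rotation_of_mem_imaginary hu1' (Subtype.mem _), hr,
          LinearIsometryEquiv.coe_mul, Function.comp_apply, reflection_orthogonal_singleton hu1, smul_neg, neg_smul]
        rfl

theorem exists_isometry_map_le {E : Type*} [NormedAddCommGroup E] [InnerProductSpace ℝ E]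
    [FiniteDimensional ℝ E] {S T : Submodule ℝ E} (h : Module.finrank ℝ S = Module.finrank ℝ T) :
    ∃ ψ : E ≃ₗᵢ[ℝ] E, ∀ x ∈ S, ψ x ∈ T := by
  let e : S ≃ₗᵢ[ℝ] T :=
    (stdOrthonormalBasis ℝ S).equiv (stdOrthonormalBasis ℝ T) (finCongr h)
  let f : S →ₗᵢ[ℝ] E := T.subtypeₗᵢ.comp e.toLinearIsometry
  refine ⟨f.extend.toLinearIsometryEquiv rfl, fun x hx => ?_⟩
  have := f.extend_apply ⟨x, hx⟩
  change f.extend x ∈ T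
  rw [this]
  exact (e ⟨x, hx⟩).2

/-- A four-plane that is `ℍ`-Lagrangian with respect to `{0} × ℍ` is `ℍ` or `ℍᗮ`. -/
theorem eq_quaternions_or_eq_coquaternions {C : Submodule ℝ Octonion}
    (hC : Module.finrank ℝ C = 4)
    (h : ∀ u ∈ coquaternions, ∀ x ∈ C, ∀ y ∈ C, ⟪x * u, y⟫ = 0) :
    C = quaternions ∨ C = coquaternions := by
  have key : ∀ x ∈ C, ∀ y ∈ C, x.fst * y.snd = y.fst * x.snd := by
    intro x hx y hy
    set w := conj x * y with hw
    -- Testing against the second component of `w` itself gives `‖w.snd‖² = 0`.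
    have h1 := h (WithLp.toLp 2 (0, w.snd)) rfl x hx y hy
    rw [inner_mul_right, ← hw, WithLp.prod_inner_apply] at h1
    change ⟪(0 : ℍ[ℝ]), w.fst⟫ + ⟪w.snd, w.snd⟫ = 0 at h1
    rw [inner_zero_left, zero_add, inner_self_eq_zero, hw, mul_snd, conj_fst, conj_snd, star_star,
      mul_neg, ← sub_eq_add_neg, sub_eq_zero] at h1
    exact h1
  have hq : C ≤ quaternions → C = quaternions := fun hle =>
    Submodule.eq_of_le_of_finrank_eq hle (hC.trans finrank_quaternions.symm)
  have hc : C ≤ coquaternions → C = coquaternions := fun hle =>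
    Submodule.eq_of_le_of_finrank_eq hle (hC.trans finrank_coquaternions.symm)
  by_cases h₁ : ∃ x ∈ C, x.fst ≠ 0 ∧ x.snd ≠ 0
  -- With `x = (p, s)` and `p, s ≠ 0`, first coordinates identify `C` with `ℍ`, so `C` consists of
  -- the vectors `(p * a, a * s)`. The relation `key` between two of them then forces `ℍ` to be
  -- commutative.
  · exfalso
    obtain ⟨x, hx, hp, hs⟩ := h₁
    let f : C →ₗ[ℝ] ℍ[ℝ] := ((LinearMap.fst ℝ ℍ[ℝ] ℍ[ℝ]).comp
      (WithLp.linearEquiv 2 ℝ (ℍ[ℝ] × ℍ[ℝ])).toLinearMap).comp C.subtype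
    have hf : Function.Injective f := by
      rw [← LinearMap.ker_eq_bot, LinearMap.ker_eq_bot']
      intro y hy
      change y.1.fst = 0 at hy
      have := key x hx y y.2
      rw [hy, zero_mul] at this
      exact Subtype.ext (Octonion.ext hy ((mul_eq_zero.1 this).resolve_left hp))
    have hsurj : Function.Surjective f :=
      (LinearMap.injective_iff_surjective_of_finrank_eq_finrank
        (hC.trans Quaternion.finrank_eq_four.symm)).1 hf
    have comm : ∀ a b : ℍ[ℝ], a * b = b * a := by
      intro a b
      obtain ⟨y, hy⟩ := hsurj (x.fst * a)
      obtain ⟨z, hz⟩ := hsurj (x.fst * b)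
      change y.1.fst = _ at hy
      change z.1.fst = _ at hz
      have hy' := key x hx y y.2
      have hz' := key x hx z z.2
      have hyz := key y y.2 z z.2
      rw [hy, mul_assoc] at hy'
      rw [hz, mul_assoc] at hz'
      rw [hy, hz, mul_left_cancel₀ hp hy', mul_left_cancel₀ hp hz', mul_assoc, mul_assoc] at hyz
      have := mul_left_cancel₀ hp hyz
      rw [← mul_assoc, ← mul_assoc] at this
      exact mul_right_cancel₀ hs this
    have hk : ∀ a b : ℍ[ℝ], (a * b).imK = (b * a).imK := fun a b => by rw [comm]
    simp only [Quaternion.imK_mul] at hk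
    have := hk ⟨0, 1, 0, 0⟩ ⟨0, 0, 1, 0⟩
    norm_num at this
  · push Not at h₁
    have hne : C ≠ ⊥ := by rintro rfl; simp at hC
    obtain ⟨x, hx, h0⟩ := C.ne_bot_iff.1 hne
    by_cases hp : x.fst = 0
    · have hs : x.snd ≠ 0 := fun hs => h0 (Octonion.ext hp hs)
      refine Or.inr (hc fun y hy => ?_)
      have := key x hx y hy
      rw [hp, zero_mul, eq_comm] at this
      exact (mul_eq_zero.1 this).resolve_right hs
    · refine Or.inl (hq fun y hy => ?_)
      have := key x hx y hy
      rw [h₁ x hx hp, mul_zero] at this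
      exact (mul_eq_zero.1 this).resolve_left hp

theorem isSpin7Translate_of_map {C : Submodule ℝ Octonion} {φ : Octonion ≃ₗᵢ[ℝ] Octonion}
    (hφ : φ ∈ spin7)
    (h : C.map (φ.toLinearEquiv : Octonion →ₗ[ℝ] Octonion) = quaternions) :
    IsSpin7Translate C := by
  refine ⟨φ⁻¹, inv_mem hφ, ?_⟩
  rw [← h]
  ext x
  simp only [Submodule.mem_map]
  constructor
  · exact fun hx => ⟨φ x, ⟨x, hx, rfl⟩, φ.symm_apply_apply x⟩
  · rintro ⟨_, ⟨y, hy, rfl⟩, rfl⟩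
    change φ.symm (φ y) ∈ C
    rwa [φ.symm_apply_apply]

theorem IsHLagrangian.isSpin7Translate {C : Submodule ℝ Octonion} (h : IsHLagrangian C) :
    IsSpin7Translate C := by
  obtain ⟨hC, L, hL, hL4, h⟩ := isHLagrangian_iff.1 h
  have hdim : ∀ M ≤ imaginary, Module.finrank ℝ M = 4 →
      Module.finrank ℝ (M.comap imaginary.subtype) = 4 := fun M hM h4 =>
    (Submodule.comapSubtypeEquivOfLe hM).finrank_eq.trans h4
  obtain ⟨ψ, hψ⟩ := exists_isometry_map_le ((hdim L hL hL4).trans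
    (hdim _ coquaternions_le_imaginary finrank_coquaternions).symm)
  obtain ⟨φ, hφ, θ, hφθ, ε, hθ⟩ := exists_spin7_twist ψ
  have hLθ : L.map (θ.toLinearEquiv : Octonion →ₗ[ℝ] Octonion) = coquaternions := by
    refine Submodule.eq_of_le_of_finrank_eq ?_ ?_
    · rintro _ ⟨x, hx, rfl⟩
      have e := hθ ⟨x, hL hx⟩
      change θ x ∈ coquaternions
      rw [show θ x = _ from e]
      exact coquaternions.smul_mem _ (hψ ⟨x, hL hx⟩ hx)
    · rw [finrank_map_isometry, hL4, finrank_coquaternions]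
  have h' := inner_mul_eq_zero_map hφθ h
  rw [hLθ] at h'
  rcases eq_quaternions_or_eq_coquaternions ((finrank_map_isometry φ C).trans hC) h' with e | e
  · exact isSpin7Translate_of_map hφ e
  -- Right multiplication by `(0, 1)` sends `{0} × ℍ` to `ℍ`.
  · let u : Octonion := WithLp.toLp 2 (0, 1)
    have hu : ‖u‖ = 1 := by
      rw [norm_eq_sqrt_real_inner, inner_eq]
      simp [u]
    have hi : u ∈ imaginary := rfl
    refine isSpin7Translate_of_map (mul_mem (rightMul_mem_spin7 hu hi) hφ) ?_
    refine Submodule.eq_of_le_of_finrank_eq ?_ ?_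
    · rintro _ ⟨x, hx, rfl⟩
      have hx' : φ x ∈ coquaternions := e ▸ Submodule.mem_map_of_mem hx
      rw [mem_coquaternions] at hx'
      change (φ x * u).snd = 0
      rw [mul_snd, hx']
      simp [u]
    · rw [finrank_map_isometry, hC, finrank_quaternions]

/-! ### Calibration by the Cayley form -/

theorem norm_tripleCross {x y z : Octonion} (hxy : ⟪x, y⟫ = 0) (hyz : ⟪y, z⟫ = 0)
    (hxz : ⟪x, z⟫ = 0) : ‖tripleCross x y z‖ = ‖x‖ * (‖y‖ * ‖z‖) := by
  rw [(tripleCross_eq_cyclic hxy hyz hxz).1, norm_mul, norm_mul, norm_conj]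

theorem norm_tripleCross_of_orthonormal {v : Fin 4 → Octonion} (hv : Orthonormal ℝ v) :
    ‖tripleCross (v 1) (v 2) (v 3)‖ = 1 := by
  rw [norm_tripleCross (hv.2 (by decide)) (hv.2 (by decide)) (hv.2 (by decide)), hv.1, hv.1, hv.1]
  norm_num

theorem isCalibratingForm_cayleyForm : IsCalibratingForm cayleyForm := by
  intro v hv
  rw [cayleyForm_apply]
  refine (real_inner_le_norm _ _).trans ?_
  rw [hv.1, norm_tripleCross_of_orthonormal hv, one_mul]

/-- `y ↦ x̄ y` as a map that is bilinear in `x` and `y`. -/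
noncomputable def conjMul : Octonion →ₗ[ℝ] Octonion →ₗ[ℝ] Octonion :=
  LinearMap.mk₂ ℝ (fun x y => conj x * y) (fun x y z => by rw [conj_add, add_mul'])
    (fun r x y => by rw [conj_smul, smul_mul']) (fun x y z => mul_add' _ y z)
    (fun r x y => mul_smul' r _ y)

theorem finrank_map_conjMul {x : Octonion} (hx : x ≠ 0) (C : Submodule ℝ Octonion) :
    Module.finrank ℝ (C.map (conjMul x)) = Module.finrank ℝ C := by
  refine (Submodule.equivMapOfInjective (conjMul x) (fun y z h => ?_) C).finrank_eq.symm
  refine mul_left_cancel_of_ne_zero (x := conj x) ?_ h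
  rwa [← norm_ne_zero_iff, norm_conj, norm_ne_zero_iff]

theorem orthonormal_coe {C : Submodule ℝ Octonion} (e : OrthonormalBasis (Fin 4) ℝ C) :
    Orthonormal ℝ fun i => (e i : Octonion) :=
  e.orthonormal.comp_linearIsometry C.subtypeₗᵢ

theorem le_of_orthonormalBasis_mem {C N : Submodule ℝ Octonion}
    (e : OrthonormalBasis (Fin 4) ℝ C) (h : ∀ i, (e i : Octonion) ∈ N) : C ≤ N := by
  intro x hx
  have := congrArg Subtype.val (e.sum_repr ⟨x, hx⟩)
  rw [← show _ = x from this, AddSubmonoidClass.coe_finsetSum]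
  exact N.sum_mem fun i _ => N.smul_mem _ (h i)

theorem conj_mul_mem_of_abs_cayleyForm_eq_one {C : Submodule ℝ Octonion}
    (e : OrthonormalBasis (Fin 4) ℝ C) (h : |cayleyForm fun i => (e i : Octonion)| = 1)
    (i j : Fin 4) : conj (e i) * e j ∈ C.map (conjMul (e 1)) := by
  have hv := orthonormal_coe e
  set v : Fin 4 → Octonion := fun i => (e i : Octonion) with hvdef
  have hortho : ∀ i j, i ≠ j → ⟪v i, v j⟫ = 0 := fun i j hij => hv.2 hij
  set M := C.map (conjMul (v 1)) with hM
  have hmem : ∀ j, conj (v 1) * v j ∈ M := fun j => Submodule.mem_map_of_mem (e j).2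
  have hswap : ∀ i j, i ≠ j → conj (v i) * v j ∈ M → conj (v j) * v i ∈ M := by
    intro i j hij hm
    rw [conj_mul_of_inner_eq_zero (hortho j i hij.symm)]
    exact M.neg_mem hm
  have hself : ∀ i, conj (v i) * v i ∈ M := by
    intro i
    have := hmem 1
    rw [conj_mul_self, hv.1] at this ⊢
    exact this
  rw [cayleyForm_apply] at h
  obtain ⟨h₁, h₂, h₃⟩ := tripleCross_eq_cyclic (hortho 1 2 (by decide)) (hortho 2 3 (by decide))
    (hortho 1 3 (by decide))
  have hn := norm_tripleCross_of_orthonormal hv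
  set c := tripleCross (v 1) (v 2) (v 3) with hc
  set s := ⟪v 0, c⟫ with hs
  have hss : s * s = 1 := by rw [← abs_mul_abs_self, h, one_mul]
  -- Equality case of Cauchy–Schwarz for the unit vectors `v 0` and `c`. Each cyclic form of `c`
  -- then turns one product `conj (v i) * v 0` into a product of the two remaining vectors.
  have h0 : v 0 = s • c := by
    rw [← sub_eq_zero, ← norm_eq_zero, ← sq_eq_zero_iff, norm_sub_sq_real, real_inner_smul_right,
      ← hs, norm_smul, hv.1, hn, Real.norm_eq_abs, h, hss]
    norm_num
  have h10 : conj (v 1) * v 0 = s • (conj (v 2) * v 3) := by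
    rw [h0, mul_smul', h₁, conj_mul_self_mul, hv.1, one_pow, one_smul]
  have h20 : conj (v 2) * v 0 = s • (conj (v 3) * v 1) := by
    rw [h0, mul_smul', h₂, conj_mul_self_mul, hv.1, one_pow, one_smul]
  have h30 : conj (v 3) * v 0 = s • (conj (v 1) * v 2) := by
    rw [h0, mul_smul', h₃, conj_mul_self_mul, hv.1, one_pow, one_smul]
  have m23 : conj (v 2) * v 3 ∈ M := by
    have := M.smul_mem s (hmem 0)
    rwa [h10, smul_smul, hss, one_smul] at this
  have m31 : conj (v 3) * v 1 ∈ M := hswap 1 3 (by decide) (hmem 3)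
  have m20 : conj (v 2) * v 0 ∈ M := h20 ▸ M.smul_mem s m31
  have m30 : conj (v 3) * v 0 ∈ M := h30 ▸ M.smul_mem s (hmem 2)
  change conj (v i) * v j ∈ M
  fin_cases i <;> fin_cases j
  · exact hself 0
  · exact hswap 1 0 (by decide) (hmem 0)
  · exact hswap 2 0 (by decide) m20
  · exact hswap 3 0 (by decide) m30
  · exact hmem 0
  · exact hmem 1
  · exact hmem 2
  · exact hmem 3
  · exact m20
  · exact hswap 1 2 (by decide) (hmem 2)
  · exact hself 2
  · exact m23
  · exact m30
  · exact m31
  · exact hswap 2 3 (by decide) m23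
  · exact hself 3

theorem isHLagrangian_of_abs_cayleyForm_eq_one {C : Submodule ℝ Octonion}
    (e : OrthonormalBasis (Fin 4) ℝ C) (h : |cayleyForm fun i => (e i : Octonion)| = 1) :
    IsHLagrangian C := by
  have hC : Module.finrank ℝ C = 4 := by
    rw [Module.finrank_eq_card_basis e.toBasis, Fintype.card_fin]
  have hn : ‖(e 1 : Octonion)‖ = 1 := (orthonormal_coe e).1 1
  have key : ∀ x ∈ C, ∀ y ∈ C, conj x * y ∈ C.map (conjMul (e 1)) := by
    intro x hx y hy
    have h₁ : ∀ i, C ≤ (C.map (conjMul (e 1))).comap (conjMul (e i)) := fun i =>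
      le_of_orthonormalBasis_mem e fun j => conj_mul_mem_of_abs_cayleyForm_eq_one e h i j
    have h₂ : C ≤ (C.map (conjMul (e 1))).comap (conjMul.flip y) :=
      le_of_orthonormalBasis_mem e fun i => h₁ i hy
    exact h₂ hx
  have hM := finrank_map_conjMul (x := (e 1 : Octonion)) (by
    rw [← norm_ne_zero_iff, hn]; exact one_ne_zero) C
  refine isHLagrangian_iff.2 ⟨hC, (C.map (conjMul (e 1)))ᗮ, fun u hu => ?_, ?_,
    fun u hu x hx y hy => ?_⟩
  · have := key _ (e 1).2 _ (e 1).2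
    rw [conj_mul_self, hn, one_pow, one_smul] at this
    exact mem_imaginary_iff_inner.2 (Submodule.inner_right_of_mem_orthogonal this hu)
  · have := (C.map (conjMul (e 1))).finrank_add_finrank_orthogonal
    rw [hM, hC, finrank_octonion] at this
    omega
  · rw [inner_mul_right]
    exact Submodule.inner_left_of_mem_orthogonal (key x hx y hy) hu

theorem IsHLagrangian.abs_cayleyForm_eq_one {C : Submodule ℝ Octonion} (hC : IsHLagrangian C)
    (e : OrthonormalBasis (Fin 4) ℝ C) : |cayleyForm fun i => (e i : Octonion)| = 1 := by
  obtain ⟨hC, L, -, hL, h⟩ := isHLagrangian_iff.1 hC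
  have hv := orthonormal_coe e
  set v : Fin 4 → Octonion := fun i => (e i : Octonion) with hvdef
  have hortho : ∀ i j, i ≠ j → ⟪v i, v j⟫ = 0 := fun i j hij => hv.2 hij
  have key : ∀ x ∈ C, ∀ y ∈ C, conj x * y ∈ Lᗮ := fun x hx y hy =>
    (Submodule.mem_orthogonal _ _).2 fun u hu => by rw [← inner_mul_right]; exact h u hu x hx y hy
  -- Both sides have dimension four. So `conj (v 2) * v 3 ∈ Lᗮ` has the form `conj (v 1) * y` with
  -- `y ∈ C`, and multiplying by `v 1` puts the triple product in `C`.
  have hM : C.map (conjMul (v 1)) = Lᗮ := by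
    refine Submodule.eq_of_le_of_finrank_eq ?_ ?_
    · rintro _ ⟨y, hy, rfl⟩
      exact key _ (e 1).2 y hy
    · have := L.finrank_add_finrank_orthogonal
      rw [hL, finrank_octonion] at this
      rw [finrank_map_conjMul (by rw [← norm_ne_zero_iff, hv.1]; exact one_ne_zero), hC]
      omega
  have hc : tripleCross (v 1) (v 2) (v 3) ∈ C := by
    rw [(tripleCross_eq_cyclic (hortho 1 2 (by decide)) (hortho 2 3 (by decide))
      (hortho 1 3 (by decide))).1]
    have := key _ (e 2).2 _ (e 3).2
    rw [← hM] at this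
    obtain ⟨y, hy, hy'⟩ := this
    change v 1 * (conj (v 2) * v 3) ∈ C
    rw [← show conj (v 1) * y = conj (v 2) * v 3 from hy', self_mul_conj_mul, hv.1, one_pow,
      one_smul]
    exact hy
  have hn := norm_tripleCross_of_orthonormal hv
  rw [cayleyForm_apply]
  set c := tripleCross (v 1) (v 2) (v 3) with hcdef
  -- Parseval in `C`: the unit vector `c` is orthogonal to `v 1`, `v 2`, `v 3`, so its whole norm
  -- sits in the `v 0` coordinate.
  have hsum := e.sum_sq_norm_inner_right ⟨c, hc⟩
  have h₁ : ⟪v 1, c⟫ = 0 := (inner_tripleCross_self (v 1) (v 2) (v 3)).1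
  have h₂ : ⟪v 2, c⟫ = 0 := (inner_tripleCross_self (v 2) (v 1) (v 3)).2.1
  have h₃ : ⟪v 3, c⟫ = 0 := (inner_tripleCross_self (v 3) (v 1) (v 2)).2.2
  rw [Fin.sum_univ_four] at hsum
  change ‖⟪v 0, c⟫‖ ^ 2 + ‖⟪v 1, c⟫‖ ^ 2 + ‖⟪v 2, c⟫‖ ^ 2 + ‖⟪v 3, c⟫‖ ^ 2 = ‖c‖ ^ 2 at hsum
  rw [h₁, h₂, h₃, hn] at hsum
  have : |⟪v 0, c⟫| ^ 2 = 1 ^ 2 := by simpa using hsum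
  exact (sq_eq_sq₀ (abs_nonneg _) zero_le_one).1 this

theorem isCalibratedBy_cayleyForm_iff {C : Submodule ℝ Octonion}
    (hC : Module.finrank ℝ C = 4) : IsCalibratedBy cayleyForm C ↔ IsHLagrangian C := by
  have e : OrthonormalBasis (Fin 4) ℝ C := (stdOrthonormalBasis ℝ C).reindex (finCongr hC)
  constructor
  · rintro ⟨-, hfact, o, ho⟩
    refine isHLagrangian_of_abs_cayleyForm_eq_one e ?_
    rw [← o.abs_volumeForm_apply_of_orthonormal e, ← ho]
    rfl
  · intro h
    have hfact : Fact (Module.finrank ℝ C = 4) := ⟨hC⟩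
    refine ⟨isCalibratingForm_cayleyForm, hfact, ?_⟩
    -- A top-degree form on `C` is its value on the basis times the determinant; that value is `±1`,
    -- and the sign selects the orientation.
    have hb := (cayleyForm.compLinearMap C.subtype).eq_smul_basis_det e.toBasis
    have hv := e.toBasis.orientation.volumeForm_robust e rfl
    have h1 : (cayleyForm.compLinearMap C.subtype) e.toBasis =
        cayleyForm fun i => (e i : Octonion) := by
      rw [e.coe_toBasis]; rfl
    rw [h1] at hb
    rcases eq_or_eq_neg_of_abs_eq (h.abs_cayleyForm_eq_one e) with hs | hs
    · exact ⟨e.toBasis.orientation, by rw [hb, hs, hv, one_smul]⟩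
    · exact ⟨-e.toBasis.orientation, by
        rw [hb, hs, Orientation.volumeForm_neg_orientation, hv]
        ext w
        simp⟩

end Octonion

theorem mainTheorem5 (C : Submodule ℝ Octonion) (hC : Module.finrank ℝ C = 4) :
    (Octonion.IsHLagrangian C ↔ Octonion.IsSpin7Translate C) ∧
      (Octonion.IsHLagrangian C ↔ IsCalibratedBy Octonion.cayleyForm C) :=
  ⟨⟨fun h => h.isSpin7Translate, fun h => h.isHLagrangian⟩,
    (Octonion.isCalibratedBy_cayleyForm_iff hC).symm⟩
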